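/- Let $X$ be a real Banach space with continuous dual $X^*$. A set-valued operator $A\colon X\rightrightarrows X^*$ assigns to every $x\in X$ a set $Ax\subseteq X^*$; its graph is $\operatorname{gra}A=\{(x,x^*)\in X\times X^* : x^*\in Ax\}$ and its domain is $\operatorname{dom}A=\{x\in X : Ax\ne\varnothing\}$. The sum of two operators is given by $(A+B)x=\{a^*+b^* : a^*\in Ax,\ b^*\in Bx\}$. The operator $A$ is monotone if $\langle x-y,x^*-y^*\rangle\ge 0$ for all $(x,x^*),(y,y^*)\in\operatorname{gra}A$, and maximal monotone if it is monotone and no monotone operator has a graph that properly contains $\operatorname{gra}A$. A maximal monotone operator $A$ is of type (FPV) if for every open convex set $U\subseteq X$ with $U\cap\operatorname{dom}A\neq\varnothing$ the following holds: whenever $x\in U$ and $x^*\in X^*$ satisfy $\langle x-y,x^*-y^*\rangle\ge 0$ for all $(y,y^*)\in\operatorname{gra}A\cap(U\times X^*)$, then $(x,x^*)\in\operatorname{gra}A$. For $C\subseteq X$, the normal cone operator $N_C$ is given by $N_C(x)=\{x^*\in X^* : \langle c-x,x^*\rangle\le 0 \text{ for all } c\in C\}$ if $x\in C$, and $N_C(x)=\varnothing$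 if $x\notin C$. Closures and interiors are taken in the norm topology. Theorem. Let $A,B\colon X\rightrightarrows X^*$ be maximal monotone with $\operatorname{dom}A\cap\operatorname{int}\operatorname{dom}B\neq\varnothing$. Assume that $A+N_{\overline{\operatorname{dom}B}}$ is maximal monotone of type (FPV) and that $\operatorname{dom}A\cap\overline{\operatorname{dom}B}\subseteq\operatorname{dom}B$. Then $A+B$ is maximal monotone. -/

import Mathlib

open scoped Pointwise

namespace MonotoneOp

/- A set-valued operator from `X` to its continuous dual is a map `A : X → Set (StrongDual ℝ X)`.
The sum of two such operators is the pointwise Minkowski sum: `(A + B) x = A x + B x`. -/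

variable {X : Type*} [NormedAddCommGroup X] [NormedSpace ℝ X]

/-- The graph of a set-valued operator. -/
def graph (A : X → Set (StrongDual ℝ X)) : Set (X × StrongDual ℝ X) :=
  {p | p.2 ∈ A p.1}

/-- The domain of a set-valued operator. -/
def dom (A : X → Set (StrongDual ℝ X)) : Set X :=
  {x | (A x).Nonempty}

/-- `A` is monotone: `⟨x - y, x* - y*⟩ ≥ 0` for all `(x, x*)`, `(y, y*)` in its graph. -/
def IsMonotone (A : X → Set (StrongDual ℝ X)) : Prop :=
  ∀ p ∈ graph A, ∀ q ∈ graph A, 0 ≤ (p.2 - q.2) (p.1 - q.1)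

/-- `A` is maximal monotone: it is monotone and has no proper monotone extension, in the sense of
graph inclusion. -/
def IsMaximalMonotone (A : X → Set (StrongDual ℝ X)) : Prop :=
  IsMonotone A ∧
    ∀ T : X → Set (StrongDual ℝ X), IsMonotone T → graph A ⊆ graph T → graph T = graph A

/-- `p = (x, x*)` is monotonically related to the set `G` of pairs. -/
def MonotonicallyRelated (p : X × StrongDual ℝ X) (G : Set (X × StrongDual ℝ X)) : Prop :=
  ∀ q ∈ G, 0 ≤ (p.2 - q.2) (p.1 - q.1)

/-- `A` is maximal monotone of type (FPV): `A` is maximal monotone and, for every open convex set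
`U` that meets `dom A`, each `(x, x*)` with `x ∈ U` that is monotonically related to
`gra A ∩ (U × X*)` belongs to `gra A`. -/
def IsMaximalMonotoneFPV (A : X → Set (StrongDual ℝ X)) : Prop :=
  IsMaximalMonotone A ∧
    ∀ U : Set X, IsOpen U → Convex ℝ U → (U ∩ dom A).Nonempty →
      ∀ (x : X) (x' : StrongDual ℝ X), x ∈ U →
        MonotonicallyRelated (x, x') (graph A ∩ U ×ˢ Set.univ) → (x, x') ∈ graph A

/-- The normal cone operator of the set `C`: its value at `x ∈ C` consists of the `x*` with
`⟨c - x, x*⟩ ≤ 0` for all `c ∈ C`, and it is empty at every `x ∉ C`. -/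
def normalCone (C : Set X) (x : X) : Set (StrongDual ℝ X) :=
  {x' | x ∈ C ∧ ∀ c ∈ C, x' (c - x) ≤ 0}

end MonotoneOp

/-!
Put `C = closure (dom B)` and `M = A + N_C`. Maximality of `B` gives `N_C + B = B`, so
`A + B = M + B`, where `M` is of type (FPV), `dom M ⊆ dom B`, and `dom M` meets `int (dom B)` at
some `x₀`. It remains to prove that `M + B` is maximal, and this has two halves.

*The Fitzpatrick function of `M + B` dominates the duality pairing*, i.e.
`inf {⟨z - c, z' - c'⟩ | (c, c') ∈ gra (M + B)} ≤ 0` for every `(z, z')`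
(`exists_sub_apply_lt_of_FPV_add`). Suppose this infimum is positive. Then `z ∉ dom M`, so the
property (FPV), applied to thin tubes around the segment `[x₀, z]` and to functionals
`z' + k • v` with `v` norming `z - x₀`, produces points `a ∈ dom M` of the tube with
`⟨z - a, z' + k • v - a'⟩ < 0` for some `a' ∈ M a`. Comparing with the assumption, for `b ∈ B a`
the number `⟨z - a, b⟩` is less than `-k ⟨z - a, v⟩`. On the other hand `B` is bounded near `x₀`,
which bounds `⟨z - a, b⟩` from below. This forces `z ∈ C` (`mem_closure_dom_of_related_add`). The
same comparison settles the points `x₀ + t (z - x₀)`, `t < 1`, because `B` is bounded near the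
segment from `x₀` to such a point. The point `z` itself is reached by letting `t → 1`, using that
the Fitzpatrick function is convex.

*Splitting* (`mem_add_of_related`). Let `(z, z')` be monotonically related to `gra (M + B)`. Since
the Fitzpatrick function `F` of `M + B` dominates the pairing and touches it at `(z, z')`, the
affine function `(x, x') ↦ ⟨x, z'⟩ + ⟨z, x'⟩ - ⟨z, z'⟩` lies below `F`
(`FitzpatrickLE.subgradient`), and `F (x, x' + y') ≤ F_M (x, x') + F_B (x, y')`. A Hahn-Banach
separation in `X × ℝ` then writes `z' = (z' - y) + y` so that `(z, z' - y)` and `(z, y)` are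
monotonically related to `gra M` and `gra B` up to constants `γ` and `-γ`. By maximality `γ = 0`,
hence `z' - y ∈ M z` and `y ∈ B z`.
-/

namespace MonotoneOp

open Metric

section

variable {X : Type*} [NormedAddCommGroup X] [NormedSpace ℝ X]

/-! ### Monotone operators -/

lemma mul_norm_le_of_forall_le {f : StrongDual ℝ X} {r c : ℝ} (hr : 0 < r)
    (h : ∀ x : X, ‖x‖ ≤ r → f x ≤ c) : r * ‖f‖ ≤ c := by
  rw [← le_div_iff₀' hr]
  refine f.opNorm_bound_of_ball_bound hr c fun x hx ↦ ?_
  have hx : ‖x‖ ≤ r := by simpa using hx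
  have hneg := h (-x) (by rwa [norm_neg])
  rw [map_neg] at hneg
  exact abs_le.2 ⟨by linarith, h x hx⟩

lemma IsMaximalMonotone.mem_of_related {A : X → Set (StrongDual ℝ X)} (hA : IsMaximalMonotone A)
    {z : X} {z' : StrongDual ℝ X} (h : ∀ a, ∀ a' ∈ A a, 0 ≤ (z' - a') (z - a)) : z' ∈ A z := by
  have hT := hA.2 (fun x ↦ {x' | x' ∈ A x ∨ (x = z ∧ x' = z')}) ?_ fun p hp ↦ Or.inl hp
  · have : (z, z') ∈ graph fun x ↦ {x' | x' ∈ A x ∨ (x = z ∧ x' = z')} := Or.inr ⟨rfl, rfl⟩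
    rw [hT] at this
    exact this
  · rintro ⟨x, x'⟩ (hx | ⟨rfl, rfl⟩) ⟨y, y'⟩ (hy | ⟨rfl, rfl⟩)
    · exact hA.1 _ hx _ hy
    · have := h x x' hx
      simp only [map_sub, sub_apply] at this ⊢
      linarith
    · exact h y y' hy
    · simp

lemma IsMonotone.apply_nonneg {A : X → Set (StrongDual ℝ X)} (hA : IsMonotone A) {x y : X}
    {x' y' : StrongDual ℝ X} (hx : x' ∈ A x) (hy : y' ∈ A y) : 0 ≤ (x' - y') (x - y) :=
  hA (x, x') hx (y, y') hy

/-! ### Boundedness of monotone operators -/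

/-- A monotone operator is locally bounded at interior points of its domain. With `x₀' ∈ B x₀`, the
Banach-Steinhaus theorem applies to the functionals `(y' - x₀') / (1 + ⟨y - x₀, y' - x₀'⟩)` for
`(y, y') ∈ gra B` with `y` near `x₀`; near `x₀` the denominator can then be absorbed. -/
theorem IsMonotone.exists_norm_le_of_mem_interior_dom [CompleteSpace X]
    {B : X → Set (StrongDual ℝ X)} (hB : IsMonotone B) {x₀ : X} (hx₀ : x₀ ∈ interior (dom B)) :
    ∃ r > 0, ∃ K, 0 ≤ K ∧ ∀ x, ‖x - x₀‖ ≤ r → x ∈ dom B ∧ ∀ b ∈ B x, ‖b‖ ≤ K := by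
  obtain ⟨s, hs, hball⟩ := Metric.nhds_basis_closedBall.mem_iff.1 (mem_interior_iff_mem_nhds.1 hx₀)
  obtain ⟨x₀', hx₀'⟩ := interior_subset hx₀
  have hpos : ∀ y, ∀ y' ∈ B y, 0 ≤ (y' - x₀') (y - x₀) := fun y y' hy ↦ hB.apply_nonneg hy hx₀'
  have hbound : ∀ x : X, ∃ C, ∀ y, ∀ y' ∈ B y, ‖y - x₀‖ ≤ 1 →
      (y' - x₀') x ≤ C * (1 + (y' - x₀') (y - x₀)) := by
    intro x
    obtain ⟨c, hc, hcx⟩ : ∃ c : ℝ, 0 < c ∧ ‖c • x‖ ≤ s := by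
      refine ⟨s / (‖x‖ + 1), by positivity, ?_⟩
      rw [norm_smul, Real.norm_of_nonneg (by positivity), div_mul_eq_mul_div,
        div_le_iff₀ (by positivity)]
      nlinarith [norm_nonneg x]
    obtain ⟨w, hw⟩ : x₀ + c • x ∈ dom B := hball (by simpa [mem_closedBall, dist_eq_norm] using hcx)
    have hC : 0 ≤ ‖w - x₀'‖ * (s + 1) := by positivity
    refine ⟨(1 + ‖w - x₀'‖ * (s + 1)) / c, fun y y' hy hy1 ↦ ?_⟩
    have h1 := hB.apply_nonneg hw hy
    have h2 : (w - x₀') (c • x - (y - x₀)) ≤ ‖w - x₀'‖ * (s + 1) :=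
      (le_abs_self _).trans (((w - x₀').le_opNorm _).trans
        (mul_le_mul_of_nonneg_left ((norm_sub_le _ _).trans (add_le_add hcx hy1)) (norm_nonneg _)))
    have h3 := hpos y y' hy
    rw [div_mul_eq_mul_div, le_div_iff₀ hc]
    have h4 := mul_nonneg hC h3
    generalize ‖w - x₀'‖ * (s + 1) = C at *
    simp only [map_sub, map_add, map_smul, smul_eq_mul, sub_apply] at *
    linarith
  let ι := {p : X × StrongDual ℝ X // p.2 ∈ B p.1 ∧ ‖p.1 - x₀‖ ≤ 1}
  let g : ι → StrongDual ℝ X := fun p ↦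
    (1 + (p.1.2 - x₀') (p.1.1 - x₀))⁻¹ • (p.1.2 - x₀')
  obtain ⟨R, hR⟩ : ∃ R, ∀ i, ‖g i‖ ≤ R := by
    refine banach_steinhaus fun x ↦ ?_
    obtain ⟨C₁, h₁⟩ := hbound x
    obtain ⟨C₂, h₂⟩ := hbound (-x)
    refine ⟨max C₁ C₂, fun ⟨⟨y, y'⟩, hy, hy1⟩ ↦ ?_⟩
    have hp : 0 < 1 + (y' - x₀') (y - x₀) := by linarith [hpos y y' hy]
    have h₁ := h₁ y y' hy hy1
    have h₂ := h₂ y y' hy hy1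
    change ‖(1 + (y' - x₀') (y - x₀))⁻¹ * (y' - x₀') x‖ ≤ _
    rw [Real.norm_eq_abs, abs_mul, abs_of_pos (inv_pos.2 hp), inv_mul_le_iff₀ hp, abs_le, mul_comm]
    rw [map_neg] at h₂
    constructor
    · nlinarith [le_max_right C₁ C₂]
    · nlinarith [le_max_left C₁ C₂]
  set R' := max R 1
  have hR' : 1 ≤ R' := le_max_right _ _
  refine ⟨min s (1 / (2 * R')), by positivity, 2 * R' + ‖x₀'‖, by positivity, fun x hx ↦
    ⟨hball (by simpa [mem_closedBall, dist_eq_norm] using hx.trans (min_le_left _ _)), fun b hb ↦ ?_⟩⟩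
  have hx2 : ‖x - x₀‖ ≤ 1 / (2 * R') := hx.trans (min_le_right _ _)
  have hx1 : ‖x - x₀‖ ≤ 1 := hx2.trans (by rw [div_le_one (by positivity)]; linarith)
  have hp : 0 < 1 + (b - x₀') (x - x₀) := by linarith [hpos x b hb]
  have h1 : ‖(1 + (b - x₀') (x - x₀))⁻¹ • (b - x₀')‖ ≤ R' :=
    (hR ⟨(x, b), hb, hx1⟩).trans (le_max_left _ _)
  rw [norm_smul, Real.norm_of_nonneg (inv_pos.2 hp).le, inv_mul_le_iff₀ hp] at h1
  have h2 : (b - x₀') (x - x₀) ≤ ‖b - x₀'‖ * (1 / (2 * R')) :=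
    (le_abs_self _).trans (((b - x₀').le_opNorm _).trans
      (mul_le_mul_of_nonneg_left hx2 (norm_nonneg _)))
  have h3 : ‖b - x₀'‖ ≤ 2 * R' := by
    have : ‖b - x₀'‖ * (1 / (2 * R')) * R' = ‖b - x₀'‖ / 2 := by field_simp
    nlinarith
  have := norm_add_le (b - x₀') x₀'
  rw [sub_add_cancel] at this
  linarith

/-- Boundedness of `B` near `x₀` spreads to a neighbourhood of `[x₀, x₀ + t (z - x₀)]`, `t < 1`, for
`z` in the closure of the domain: a point of this segment is the centre of a shrunken copy of a ball
around `x₀`, with dilation centre in `dom B`, and monotonicity at the two kinds of points bounds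
`b` on that copy. -/
theorem IsMonotone.exists_norm_le_near_segment {B : X → Set (StrongDual ℝ X)} (hB : IsMonotone B)
    {x₀ z : X} {r K t : ℝ} (hr : 0 < r) (hK : 0 ≤ K)
    (hloc : ∀ x, ‖x - x₀‖ ≤ r → x ∈ dom B ∧ ∀ b ∈ B x, ‖b‖ ≤ K)
    (hz : z ∈ closure (dom B)) (ht : t < 1) :
    ∃ δ > 0, ∃ L, 0 ≤ L ∧ ∀ s, 0 ≤ s → s ≤ t → ∀ a, ‖a - (x₀ + s • (z - x₀))‖ < δ →
      ∀ b ∈ B a, ‖b‖ ≤ L := by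
  have ht' : 0 < 1 - t := by linarith
  -- `z` need not lie in `dom B`, so it is replaced by a nearby point `y` of `dom B`.
  obtain ⟨y, ⟨y', hy'⟩, hyz⟩ := Metric.mem_closure_iff.1 hz ((1 - t) * r / 4) (by positivity)
  rw [dist_eq_norm] at hyz
  set D := 2 * r + ‖y - x₀‖
  have hD : 0 ≤ D := by positivity
  set Q := (K + ‖y'‖) * D
  have hQ : 0 ≤ Q := by positivity
  refine ⟨(1 - t) * r / 4, by positivity, 2 * Q / ((1 - t) * r), by positivity, ?_⟩
  intro s hs hst a ha b hb
  have hs' : 0 < 1 - s := by linarith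
  obtain ⟨e, rfl⟩ : ∃ e, a = x₀ + s • (y - x₀) + e := ⟨a - (x₀ + s • (y - x₀)), by abel⟩
  have he : ‖e‖ ≤ (1 - s) * r / 2 := by
    have h1 : e = (x₀ + s • (y - x₀) + e - (x₀ + s • (z - x₀))) + s • (z - y) := by module
    have h2 : ‖s • (z - y)‖ ≤ ‖z - y‖ := by
      rw [norm_smul, Real.norm_of_nonneg hs]
      nlinarith [norm_nonneg (z - y)]
    have h3 := norm_add_le (x₀ + s • (y - x₀) + e - (x₀ + s • (z - x₀))) (s • (z - y))
    rw [← h1] at h3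
    nlinarith
  have her : ‖e‖ ≤ r := by nlinarith
  have hsn : ‖s • (y - x₀)‖ ≤ ‖y - x₀‖ := by
    rw [norm_smul, Real.norm_of_nonneg hs]
    nlinarith [norm_nonneg (y - x₀)]
  have hsn' : ‖(1 - s) • (y - x₀)‖ ≤ ‖y - x₀‖ := by
    rw [norm_smul, Real.norm_of_nonneg hs'.le]
    nlinarith [norm_nonneg (y - x₀)]
  have key : (1 - s) * r * ‖b‖ ≤ ‖b‖ * ((1 - s) * r / 2) + Q := by
    rw [mul_assoc, ← le_div_iff₀' hs']
    refine mul_norm_le_of_forall_le hr fun h hh ↦ ?_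
    rw [le_div_iff₀' hs']
    obtain ⟨⟨w, hw⟩, hwK⟩ := hloc (x₀ + h) (by simpa using hh)
    have h1 := hB.apply_nonneg hw hb
    have h2 := hB.apply_nonneg hy' hb
    rw [show x₀ + h - (x₀ + s • (y - x₀) + e) = h - s • (y - x₀) - e by abel,
      sub_apply] at h1
    rw [show y - (x₀ + s • (y - x₀) + e) = (1 - s) • (y - x₀) - e by module,
      sub_apply] at h2
    have h3 : w (h - s • (y - x₀) - e) ≤ K * D := by
      refine (le_abs_self _).trans (w.le_of_opNorm_le_of_le (hwK w hw) ?_)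
      have := norm_sub_le (h - s • (y - x₀)) e
      have := norm_sub_le h (s • (y - x₀))
      simp only [D]; linarith
    have h4 : y' ((1 - s) • (y - x₀) - e) ≤ ‖y'‖ * D := by
      refine (le_abs_self _).trans (y'.le_of_opNorm_le_of_le le_rfl ?_)
      have := norm_sub_le ((1 - s) • (y - x₀)) e
      simp only [D]; linarith
    have h5 : b e ≤ ‖b‖ * ((1 - s) * r / 2) :=
      (le_abs_self _).trans (b.le_of_opNorm_le_of_le le_rfl he)
    -- With `a = x₀ + s (y - x₀) + e`, `(1 - s) h - e = (1 - s) (x₀ + h - a) + s (y - a)`.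
    have h6 : (1 - s) * b h = (1 - s) * b (h - s • (y - x₀) - e) +
        s * b ((1 - s) • (y - x₀) - e) + b e := by
      simp only [map_sub, map_smul, smul_eq_mul]; ring
    have h7 : (1 - s) * b (h - s • (y - x₀) - e) ≤ 1 * (K * D) :=
      (mul_le_mul_of_nonneg_left (by linarith) hs'.le).trans
        (mul_le_mul_of_nonneg_right (by linarith) (by positivity))
    have h8 : s * b ((1 - s) • (y - x₀) - e) ≤ 1 * (‖y'‖ * D) :=
      (mul_le_mul_of_nonneg_left (by linarith) hs).trans
        (mul_le_mul_of_nonneg_right (by linarith) (by positivity))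
    simp only [Q]; linarith
  rw [le_div_iff₀ (by positivity)]
  have : ‖b‖ * ((1 - t) * r) ≤ ‖b‖ * ((1 - s) * r) := by gcongr
  linarith

/-! ### Type (FPV) operators and thin tubes around segments -/

theorem IsMaximalMonotoneFPV.exists_near_segment {M : X → Set (StrongDual ℝ X)}
    (hM : IsMaximalMonotoneFPV M) {x₀ z : X} (hx₀ : x₀ ∈ dom M) (hz : z ∉ dom M) {ρ : ℝ}
    (hρ : 0 < ρ) (w : StrongDual ℝ X) :
    ∃ s : ℝ, 0 ≤ s ∧ s ≤ 1 ∧ ∃ e : X, ‖e‖ < ρ ∧ ∃ a' ∈ M (x₀ + s • (z - x₀) + e),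
      (w - a') (z - (x₀ + s • (z - x₀) + e)) < 0 := by
  by_contra! hcon
  refine hz ⟨w, hM.2 (thickening ρ (segment ℝ x₀ z)) isOpen_thickening
    ((convex_segment x₀ z).thickening ρ)
    ⟨x₀, self_subset_thickening hρ _ (left_mem_segment ℝ x₀ z), hx₀⟩ z w
    (self_subset_thickening hρ _ (right_mem_segment ℝ x₀ z)) ?_⟩
  rintro ⟨a, a'⟩ ⟨ha', ha, -⟩
  obtain ⟨y, hy, hay⟩ := mem_thickening_iff.1 ha
  rw [segment_eq_image'] at hy
  obtain ⟨s, ⟨hs, hs1⟩, rfl⟩ := hy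
  have := hcon s hs hs1 (a - (x₀ + s • (z - x₀))) (by rwa [← dist_eq_norm]) a'
  simp only [add_sub_cancel] at this
  exact this ha'

/-- If `B` is bounded near the segment `[x₀, z]`, then the Fitzpatrick function of `M + B` dominates
the pairing at every `(z, z')`. -/
theorem exists_sub_apply_lt_of_bounded_near_segment {M B : X → Set (StrongDual ℝ X)}
    (hM : IsMaximalMonotoneFPV M) (hMB : dom M ⊆ dom B) {x₀ z : X} (hx₀ : x₀ ∈ dom M)
    {δ L : ℝ} (hδ : 0 < δ) (hL : 0 ≤ L)
    (hb : ∀ s : ℝ, 0 ≤ s → s ≤ 1 → ∀ a, ‖a - (x₀ + s • (z - x₀))‖ < δ → ∀ b ∈ B a, ‖b‖ ≤ L)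
    (z' : StrongDual ℝ X) {ε : ℝ} (hε : 0 < ε) :
    ∃ c, ∃ c' ∈ (M + B) c, (z' - c') (z - c) < ε := by
  by_contra! hcon
  have hz : z ∉ dom M := fun hz ↦ by
    obtain ⟨m, hm⟩ := hz
    obtain ⟨b, hb⟩ := hMB ⟨m, hm⟩
    have := hcon z (m + b) (Set.add_mem_add hm hb)
    simp only [sub_self, map_zero] at this
    linarith
  obtain ⟨v, hv1, hv⟩ := exists_dual_vector'' ℝ (z - x₀)
  set ρ := min δ (ε / (2 * (L + 1)))
  have hρ : 0 < ρ := by positivity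
  -- The slope `L` is the bound on `b`: then `-L ⟨z - a, v⟩` and the lower bound `-L ‖z - a‖` of
  -- `⟨z - a, b⟩` differ by at most `2 L ρ`, which is smaller than `ε`.
  obtain ⟨s, hs, hs1, e, he, a', ha', hlt⟩ := hM.exists_near_segment hx₀ hz hρ (z' + L • v)
  obtain ⟨b, hbm⟩ := hMB ⟨a', ha'⟩
  have hbL := hb s hs hs1 _ (by rw [add_sub_cancel_left]; exact he.trans_le (min_le_left _ _)) b hbm
  have hge := hcon _ (a' + b) (Set.add_mem_add ha' hbm)
  have hz_eq : z - (x₀ + s • (z - x₀) + e) = (1 - s) • (z - x₀) - e := by module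
  rw [hz_eq] at hlt hge
  replace hv : v (z - x₀) = ‖z - x₀‖ := hv
  have hρε : ρ ≤ ε / (2 * (L + 1)) := min_le_right _ _
  clear_value ρ
  clear hcon hb hz_eq
  generalize z - x₀ = d at *
  have h1 : -(L * ((1 - s) * ‖d‖ + ‖e‖)) ≤ b ((1 - s) • d - e) := by
    refine (neg_le_neg (b.le_of_opNorm_le_of_le hbL ?_)).trans (neg_abs_le _)
    refine (norm_sub_le _ _).trans ?_
    rw [norm_smul, Real.norm_of_nonneg (by linarith)]
  have h2 : v e ≤ 1 * ‖e‖ := (le_abs_self _).trans (v.le_of_opNorm_le hv1 e)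
  have h3 : ‖e‖ * (2 * (L + 1)) < ε := by
    rw [← lt_div_iff₀ (by positivity)]
    exact he.trans_le hρε
  have h4 := mul_le_mul_of_nonneg_left h2 hL
  have h5 := norm_nonneg e
  simp only [map_sub, map_smul, smul_eq_mul, sub_apply,
    add_apply, smul_apply] at hlt hge h1
  rw [hv] at hlt
  nlinarith


/-- Points monotonically related to `gra (M + B)` lie over the closure of `dom B`. Otherwise
`⟨z - a, v⟩` is bounded below by a positive constant for `a ∈ dom B` close to `[x₀, z]`, so a large
slope contradicts the lower bound for `⟨z - a, b⟩` coming from the boundedness of `B` near `x₀`. -/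
theorem mem_closure_dom_of_related_add {M B : X → Set (StrongDual ℝ X)}
    (hM : IsMaximalMonotoneFPV M) (hB : IsMonotone B) (hMB : dom M ⊆ dom B) {x₀ z : X}
    (hx₀ : x₀ ∈ dom M) {r K : ℝ} (hr : 0 < r) (hK : 0 ≤ K)
    (hloc : ∀ x, ‖x - x₀‖ ≤ r → x ∈ dom B ∧ ∀ b ∈ B x, ‖b‖ ≤ K) {z' : StrongDual ℝ X}
    (hrel : ∀ c, ∀ c' ∈ (M + B) c, 0 ≤ (z' - c') (z - c)) : z ∈ closure (dom B) := by
  by_contra hz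
  obtain ⟨d, hd, hdist⟩ : ∃ d > 0, ∀ y ∈ dom B, d ≤ ‖z - y‖ := by
    rw [Metric.mem_closure_iff] at hz
    push Not at hz
    simpa only [dist_eq_norm] using hz
  have hzM : z ∉ dom M := fun h ↦ hz (subset_closure (hMB h))
  have hN : 0 < ‖z - x₀‖ := hd.trans_le (hdist x₀ (hMB hx₀))
  obtain ⟨v, hv1, hv⟩ := exists_dual_vector'' ℝ (z - x₀)
  replace hv : v (z - x₀) = ‖z - x₀‖ := hv
  set P := K * (‖z - x₀‖ + r)
  have hP : 0 ≤ P := by positivity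
  set ρ := min r (min (d / 4) (d * r / (4 * ‖z - x₀‖)))
  have hρ : 0 < ρ := by positivity
  obtain ⟨s, hs, hs1, e, he, a', ha', hlt⟩ :=
    hM.exists_near_segment hx₀ hzM hρ (z' + (2 * P / d) • v)
  obtain ⟨b, hb⟩ := hMB ⟨a', ha'⟩
  have her : ‖e‖ < r := he.trans_le (min_le_left _ _)
  have hed : ‖e‖ < d / 4 := he.trans_le ((min_le_right _ _).trans (min_le_left _ _))
  have heN : ‖e‖ * (4 * ‖z - x₀‖) < d * r := by
    rw [← lt_div_iff₀ (by positivity)]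
    exact he.trans_le ((min_le_right _ _).trans (min_le_right _ _))
  have hz_eq : z - (x₀ + s • (z - x₀) + e) = (1 - s) • (z - x₀) - e := by module
  have hnorm : ‖(1 - s) • (z - x₀) - e‖ ≤ (1 - s) * ‖z - x₀‖ + ‖e‖ := by
    refine (norm_sub_le _ _).trans ?_
    rw [norm_smul, Real.norm_of_nonneg (by linarith)]
  have hd2 := hdist _ (hMB ⟨a', ha'⟩)
  have hge := hrel _ (a' + b) (Set.add_mem_add ha' hb)
  rw [hz_eq] at hlt hd2 hge
  have h1s : 3 * d / 4 ≤ (1 - s) * ‖z - x₀‖ := by linarith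
  have h1s' : 0 < 1 - s := by
    by_contra! h
    nlinarith
  have hes : ‖e‖ ≤ (1 - s) * r := by
    have : ‖e‖ * (4 * ‖z - x₀‖) ≤ (1 - s) * r * (4 * ‖z - x₀‖) := by nlinarith
    exact le_of_mul_le_mul_right this (by positivity)
  have hbound : ∀ w : StrongDual ℝ X, ‖w‖ ≤ K → -P ≤ w ((1 - s) • (z - x₀) - e) := by
    intro w hw
    refine (neg_le_neg (w.le_of_opNorm_le_of_le hw (hnorm.trans ?_))).trans (neg_abs_le _)
    nlinarith
  have hlower : -P ≤ b ((1 - s) • (z - x₀) - e) := by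
    rcases hs.eq_or_lt with rfl | hs0
    · refine hbound b ((hloc _ ?_).2 b hb)
      simpa using her.le
    -- The point `a` lies strictly between `x₀ + (1 - s)⁻¹ e`, where `B` is bounded, and `z`; so
    -- monotonicity of `B` compares `⟨z - a, b⟩` with `⟨z - a, w⟩`.
    · obtain ⟨⟨w, hw⟩, hwK⟩ := hloc (x₀ + (1 - s)⁻¹ • e) (by
        rw [add_sub_cancel_left, norm_smul, Real.norm_of_nonneg (by positivity),
          inv_mul_le_iff₀ h1s']
        exact hes)
      refine (hbound w (hwK w hw)).trans ?_
      have h1 := hB.apply_nonneg hb hw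
      have h2 : x₀ + s • (z - x₀) + e - (x₀ + (1 - s)⁻¹ • e) =
          (s / (1 - s)) • ((1 - s) • (z - x₀) - e) := by
        match_scalars <;> field_simp <;> ring
      rw [h2, map_smul, smul_eq_mul, mul_nonneg_iff_of_pos_left (by positivity), sub_apply] at h1
      linarith
  have hve : v e ≤ 1 * ‖e‖ := (le_abs_self _).trans (v.le_of_opNorm_le hv1 e)
  have hvlow : d / 2 ≤ v ((1 - s) • (z - x₀) - e) := by
    rw [map_sub, map_smul, hv, smul_eq_mul]
    linarith
  have hmul : P ≤ 2 * P / d * v ((1 - s) • (z - x₀) - e) :=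
    calc P = 2 * P / d * (d / 2) := by field_simp
      _ ≤ _ := by gcongr
  simp only [sub_apply, add_apply, smul_apply, smul_eq_mul] at hlt hge
  linarith

lemma exists_pos_mul_le_half (Γ : ℝ) {ε : ℝ} (hε : 0 < ε) :
    ∃ t : ℝ, 0 < t ∧ t ≤ 1 / 2 ∧ t * Γ ≤ ε / 2 := by
  refine ⟨min (1 / 2) (ε / (2 * (|Γ| + 1))), by positivity, min_le_left _ _, ?_⟩
  calc min (1 / 2) (ε / (2 * (|Γ| + 1))) * Γ
      ≤ min (1 / 2) (ε / (2 * (|Γ| + 1))) * (|Γ| + 1) :=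
        mul_le_mul_of_nonneg_left (by linarith [le_abs_self Γ]) (by positivity)
    _ ≤ ε / (2 * (|Γ| + 1)) * (|Γ| + 1) :=
        mul_le_mul_of_nonneg_right (min_le_right _ _) (by positivity)
    _ = ε / 2 := by field_simp

lemma IsMonotone.add {A B : X → Set (StrongDual ℝ X)} (hA : IsMonotone A) (hB : IsMonotone B) :
    IsMonotone (A + B) := by
  rintro ⟨x, _⟩ ⟨a, ha, b, hb, rfl⟩ ⟨y, _⟩ ⟨c, hc, d, hd, rfl⟩
  have h1 := hA.apply_nonneg ha hc
  have h2 := hB.apply_nonneg hb hd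
  simp only [sub_apply, add_apply, map_sub] at *
  linarith

/-- The Fitzpatrick function of `M + B` dominates the duality pairing. -/
theorem exists_sub_apply_lt_of_FPV_add [CompleteSpace X] {M B : X → Set (StrongDual ℝ X)}
    (hM : IsMaximalMonotoneFPV M) (hB : IsMonotone B) (hMB : dom M ⊆ dom B) {x₀ : X}
    (hx₀ : x₀ ∈ dom M) (hx₀B : x₀ ∈ interior (dom B)) (z : X) (z' : StrongDual ℝ X) {ε : ℝ}
    (hε : 0 < ε) : ∃ c, ∃ c' ∈ (M + B) c, (z' - c') (z - c) < ε := by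
  by_contra! hcon
  obtain ⟨r, hr, K, hK, hloc⟩ := hB.exists_norm_le_of_mem_interior_dom hx₀B
  have hz := mem_closure_dom_of_related_add hM hB hMB hx₀ hr hK hloc
    fun c c' hc ↦ hε.le.trans (hcon c c' hc)
  obtain ⟨m₀, hm₀⟩ := hx₀
  obtain ⟨b₀, hb₀⟩ := hMB ⟨m₀, hm₀⟩
  set x₀' := m₀ + b₀
  have hx₀' : x₀' ∈ (M + B) x₀ := Set.add_mem_add hm₀ hb₀
  set Γ := (z' - x₀') (z - x₀)
  -- Passing from `z` to `x₀ + t (z - x₀)` turns the gap `ε` into at least `t ε - t (1 - t) Γ`, so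
  -- `t` is chosen close enough to `1` for this to stay above `ε / 4`.
  obtain ⟨η, hη, hη2, hηΓ⟩ := exists_pos_mul_le_half Γ hε
  obtain ⟨t, rfl⟩ : ∃ t, η = 1 - t := ⟨1 - η, by ring⟩
  have ht0 : 1 / 2 ≤ t := by linarith
  have ht1 : t < 1 := by linarith
  obtain ⟨δ, hδ, L, hL, hb⟩ := hB.exists_norm_le_near_segment hr hK hloc hz ht1
  obtain ⟨c, c', hc, hlt⟩ := exists_sub_apply_lt_of_bounded_near_segment (B := B)
    (z := x₀ + t • (z - x₀)) hM hMB ⟨m₀, hm₀⟩ hδ hL (fun s hs hs1 a ha ↦ by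
      refine hb (s * t) (by positivity) (by nlinarith) a ?_
      rwa [add_sub_cancel_left, smul_smul] at ha) (x₀' + t • (z' - x₀'))
    (show 0 < ε / 4 by positivity)
  have h1 := hcon c c' hc
  have h2 := (hM.1.1.add hB).apply_nonneg hx₀' hc
  have h3 : (x₀' + t • (z' - x₀') - c') (x₀ + t • (z - x₀) - c) =
      (1 - t) * (x₀' - c') (x₀ - c) + t * (z' - c') (z - c) - t * ((1 - t) * Γ) := by
    simp only [Γ, sub_apply, add_apply, smul_apply, map_sub, map_add, map_smul, smul_eq_mul]
    ring
  have h4 := mul_nonneg (sub_nonneg.2 ht1.le) h2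
  nlinarith

/-! ### Fitzpatrick functions -/

/-- `v` is an upper bound for the value at `(x, x')` of the Fitzpatrick function
`(x, x') ↦ sup {⟨a, x'⟩ + ⟨x, a'⟩ - ⟨a, a'⟩ | (a, a') ∈ gra A}` of `A`. Working with upper bounds
avoids extended-real-valued suprema. -/
def FitzpatrickLE (A : X → Set (StrongDual ℝ X)) (x : X) (x' : StrongDual ℝ X) (v : ℝ) : Prop :=
  ∀ a, ∀ a' ∈ A a, x' a + a' x - a' a ≤ v

lemma IsMonotone.fitzpatrickLE {A : X → Set (StrongDual ℝ X)} (hA : IsMonotone A) {x : X}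
    {x' : StrongDual ℝ X} (hx : x' ∈ A x) : FitzpatrickLE A x x' (x' x) := by
  intro a a' ha
  have := hA.apply_nonneg hx ha
  simp only [sub_apply, map_sub] at this
  linarith

lemma FitzpatrickLE.add {A B : X → Set (StrongDual ℝ X)} {x : X} {x' y' : StrongDual ℝ X}
    {v w : ℝ} (hA : FitzpatrickLE A x x' v) (hB : FitzpatrickLE B x y' w) :
    FitzpatrickLE (A + B) x (x' + y') (v + w) := by
  rintro c _ ⟨a', ha, b', hb, rfl⟩
  have h1 := hA c a' ha
  have h2 := hB c b' hb
  simp only [add_apply]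
  linarith

lemma FitzpatrickLE.combo {A : X → Set (StrongDual ℝ X)} {x y : X} {x' y' : StrongDual ℝ X}
    {v w s t : ℝ} (hx : FitzpatrickLE A x x' v) (hy : FitzpatrickLE A y y' w) (hs : 0 ≤ s)
    (ht : 0 ≤ t) (hst : s + t = 1) :
    FitzpatrickLE A (s • x + t • y) (s • x' + t • y') (s * v + t * w) := by
  intro a a' ha
  have h1 := mul_le_mul_of_nonneg_left (hx a a' ha) hs
  have h2 := mul_le_mul_of_nonneg_left (hy a a' ha) ht
  simp only [add_apply, smul_apply, map_add, map_smul, smul_eq_mul]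
  linear_combination h1 + h2 + a' a * (hst)

/-- If the Fitzpatrick function of `S` dominates the pairing and `(z, z')` is monotonically related
to `gra S`, then `(z', z)` is a subgradient of the Fitzpatrick function at `(z, z')`, where it
equals `⟨z, z'⟩`. Proved by moving from `(z, z')` slightly towards `(x, x')`. -/
lemma FitzpatrickLE.subgradient {S : X → Set (StrongDual ℝ X)}
    (hS : ∀ (x : X) (x' : StrongDual ℝ X) (ε : ℝ), 0 < ε →
      ∃ c, ∃ c' ∈ S c, (x' - c') (x - c) < ε)
    {z : X} {z' : StrongDual ℝ X} (hz : ∀ c, ∀ c' ∈ S c, 0 ≤ (z' - c') (z - c))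
    {x : X} {x' : StrongDual ℝ X} {v : ℝ} (hv : FitzpatrickLE S x x' v) :
    z' x + x' z - z' z ≤ v := by
  by_contra! hlt
  set η := z' x + x' z - z' z - v
  have hη : 0 < η := by simp only [η]; linarith
  set Δ := (x' - z') (x - z)
  obtain ⟨t, ht0, ht1, htΔ⟩ := exists_pos_mul_le_half (-Δ) hη
  obtain ⟨c, c', hc, hlt'⟩ := hS ((1 - t) • z + t • x) ((1 - t) • z' + t • x') (t * (η / 2))
    (by positivity)
  have h1 := mul_nonneg (show 0 ≤ 1 - t by linarith) (hz c c' hc)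
  have h2 := mul_le_mul_of_nonneg_left (hv c c' hc) ht0.le
  have h3 := mul_le_mul_of_nonneg_left htΔ ht0.le
  have h4 : ((1 - t) • z' + t • x' - c') ((1 - t) • z + t • x - c) =
      (1 - t) * (z' - c') (z - c) + t * (v - (x' c + c' x - c' c)) + t * η - t * (t * (-Δ)) := by
    simp only [Δ, η, sub_apply, add_apply, smul_apply, map_sub, map_add, map_smul, smul_eq_mul]
    ring
  linarith

/-! ### Splitting the functional and maximality of the sum -/

/-- If the Fitzpatrick function of `A + B` dominates the pairing, and `B` is bounded near a point of
`dom A`, then any pair monotonically related to `gra (A + B)` belongs to it. -/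
theorem mem_add_of_related {A B : X → Set (StrongDual ℝ X)} (hA : IsMaximalMonotone A)
    (hB : IsMaximalMonotone B) {x₀ : X} (hx₀ : x₀ ∈ dom A) {r K : ℝ} (hr : 0 < r)
    (hloc : ∀ x, ‖x - x₀‖ ≤ r → x ∈ dom B ∧ ∀ b ∈ B x, ‖b‖ ≤ K)
    (hS : ∀ (x : X) (x' : StrongDual ℝ X) (ε : ℝ), 0 < ε →
      ∃ c, ∃ c' ∈ (A + B) c, (x' - c') (x - c) < ε)
    {z : X} {z' : StrongDual ℝ X} (hz : ∀ c, ∀ c' ∈ (A + B) c, 0 ≤ (z' - c') (z - c)) :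
    z' ∈ (A + B) z := by
  -- `E` is the epigraph of `x ↦ inf_{y'} (F_A (x, y') - ⟨z, y'⟩) - ⟨x - z, z'⟩` and `H` the
  -- hypograph of `x ↦ -inf_{y'} (F_B (x, y') - ⟨z, y'⟩)`, up to non-attained infima.
  let H : Set (X × ℝ) := {p | ∃ y' v, FitzpatrickLE B p.1 y' v ∧ v - y' z ≤ -p.2}
  let E : Set (X × ℝ) := {p | ∃ y' v, FitzpatrickLE A p.1 y' v ∧ v - y' z - z' (p.1 - z) ≤ p.2}
  have hH : Convex ℝ H := by
    rintro ⟨x, σ⟩ ⟨x', v, hx, hv⟩ ⟨y, τ⟩ ⟨y', w, hy, hw⟩ s t hs ht hst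
    refine ⟨s • x' + t • y', s * v + t * w, hx.combo hy hs ht hst, ?_⟩
    have h1 := mul_le_mul_of_nonneg_left hv hs
    have h2 := mul_le_mul_of_nonneg_left hw ht
    simp only [add_apply, smul_apply, smul_eq_mul, Prod.snd_add, Prod.smul_snd] at *
    linarith
  have hE : Convex ℝ E := by
    rintro ⟨x, σ⟩ ⟨x', v, hx, hv⟩ ⟨y, τ⟩ ⟨y', w, hy, hw⟩ s t hs ht hst
    refine ⟨s • x' + t • y', s * v + t * w, hx.combo hy hs ht hst, ?_⟩
    have h1 := mul_le_mul_of_nonneg_left hv hs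
    have h2 := mul_le_mul_of_nonneg_left hw ht
    simp only [add_apply, smul_apply, smul_eq_mul, Prod.snd_add, Prod.smul_snd, Prod.fst_add,
      Prod.smul_fst, map_sub, map_add, map_smul] at *
    linear_combination h1 + h2 + z' z * (-hst)
  have hsum : ∀ x σ τ, (x, σ) ∈ E → (x, τ) ∈ H → τ ≤ σ := by
    rintro x σ τ ⟨x', v, hx, hv⟩ ⟨y', w, hy, hw⟩
    have := (hx.add hy).subgradient hS hz
    simp only [add_apply, map_sub] at *
    linarith
  have hdisj : Disjoint (interior H) E := by
    rw [Set.disjoint_left]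
    rintro ⟨x, σ⟩ hxH hxE
    have hcont : Filter.Tendsto (fun τ : ℝ ↦ (x, τ)) (nhdsWithin σ (Set.Ioi σ)) (nhds (x, σ)) :=
      (Continuous.prodMk_right x).continuousAt.mono_left nhdsWithin_le_nhds
    obtain ⟨τ, hτ, hτσ⟩ := ((hcont.eventually (mem_interior_iff_mem_nhds.1 hxH)).and
      self_mem_nhdsWithin).exists
    exact (hsum x σ τ hxE hτ).not_gt hτσ
  obtain ⟨a₀, ha₀⟩ := hx₀
  have hgraphA : ∀ a, ∀ a' ∈ A a, (a, (a' - z') (a - z)) ∈ E := fun a a' ha ↦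
    ⟨a', a' a, hA.1.fitzpatrickLE ha, by simp only [sub_apply, map_sub]; linarith⟩
  have hgraphB : ∀ b, ∀ b' ∈ B b, (b, -b' (b - z)) ∈ H := fun b b' hb ↦
    ⟨b', b' b, hB.1.fitzpatrickLE hb, by simp only [map_sub]; linarith⟩
  set L := K * (r + ‖x₀ - z‖)
  have hint : (ball x₀ r) ×ˢ Set.Iio (-L) ⊆ interior H := by
    refine interior_maximal ?_ (isOpen_ball.prod isOpen_Iio)
    rintro ⟨x, σ⟩ ⟨hx, hσ⟩
    rw [mem_ball, dist_eq_norm] at hx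
    obtain ⟨⟨w, hw⟩, hwK⟩ := hloc x hx.le
    refine ⟨w, w x, hB.1.fitzpatrickLE hw, ?_⟩
    have h1 : w (x - z) ≤ L := (le_abs_self _).trans (w.le_of_opNorm_le_of_le (hwK w hw) (by
      have := norm_add_le (x - x₀) (x₀ - z)
      rw [sub_add_sub_cancel] at this
      linarith))
    rw [map_sub] at h1
    simp only [Set.mem_Iio] at hσ
    linarith
  have hbase : ((x₀, -L - 1) : X × ℝ) ∈ interior H := hint ⟨mem_ball_self hr, by simp⟩
  obtain ⟨f, u, hf0, hfH, hfE⟩ := geometric_hahn_banach_of_nonempty_interior hH hE hdisj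
    ⟨_, hbase⟩ ⟨_, hgraphA x₀ a₀ ha₀⟩
  obtain ⟨g, κ, hf⟩ : ∃ (g : StrongDual ℝ X) (κ : ℝ), ∀ x σ, f (x, σ) = g x + κ * σ := by
    refine ⟨f.comp (ContinuousLinearMap.inl ℝ X ℝ), f (0, 1), fun x σ ↦ ?_⟩
    have : ((x, σ) : X × ℝ) = (x, 0) + σ • (0, 1) := by simp
    rw [this, map_add, map_smul, smul_eq_mul, mul_comm]
    rfl
  -- The separating hyperplane is not vertical: `E` has a point over `x₀`, and `H` contains
  -- a cylinder below a ball around `x₀`, which makes a vertical functional vanish.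
  have hκ : 0 < κ := by
    have hlow : ∀ x, ‖x - x₀‖ < r → ∀ σ < -L, g x + κ * σ ≤ u := fun x hx σ hσ ↦ by
      rw [← hf]
      exact hfH _ (interior_subset (hint ⟨by rwa [mem_ball, dist_eq_norm], hσ⟩))
    have hup := hfE _ (hgraphA x₀ a₀ ha₀)
    rw [hf] at hup
    generalize (a₀ - z') (x₀ - z) = q at hup
    have h0 : 0 ≤ κ := by
      have h1 := hlow x₀ (by simpa using hr) (min (-L - 1) (q - 1))
        (by linarith [min_le_left (-L - 1) (q - 1)])
      have h2 := min_le_right (-L - 1) (q - 1)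
      by_contra! h
      nlinarith
    refine h0.lt_of_ne fun h ↦ hf0 ?_
    subst h
    have hg : g = 0 := by
      have h1 : r / 2 * ‖g‖ ≤ 0 := mul_norm_le_of_forall_le (by positivity) fun x hx ↦ by
        have := hlow (x₀ + x) (by rw [add_sub_cancel_left]; linarith) (-L - 1) (by linarith)
        rw [map_add] at this
        linarith
      have h2 : ‖g‖ ≤ 0 := by nlinarith
      simpa using h2
    ext x
    · simp [hf, hg]
    · simp [hf, hg]
  set y := κ⁻¹ • g
  set γ := κ⁻¹ * (u - g z)
  have hAγ : ∀ a, ∀ a' ∈ A a, γ ≤ (z' - y - a') (z - a) := fun a a' ha ↦ by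
    have h1 := hfE _ (hgraphA a a' ha)
    rw [hf] at h1
    simp only [γ, y]
    rw [inv_mul_le_iff₀ hκ]
    simp only [sub_apply, smul_apply, map_sub, smul_eq_mul] at h1 ⊢
    have h2 : κ * (κ⁻¹ * g z) = g z := by field_simp
    have h3 : κ * (κ⁻¹ * g a) = g a := by field_simp
    linarith
  have hBγ : ∀ b, ∀ b' ∈ B b, -γ ≤ (y - b') (z - b) := fun b b' hb ↦ by
    have h1 := hfH _ (hgraphB b b' hb)
    rw [hf] at h1
    simp only [γ, y]
    rw [← mul_neg, inv_mul_le_iff₀ hκ]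
    simp only [sub_apply, smul_apply, map_sub, smul_eq_mul] at h1 ⊢
    have h2 : κ * (κ⁻¹ * g z) = g z := by field_simp
    have h3 : κ * (κ⁻¹ * g b) = g b := by field_simp
    linarith
  -- Whichever of `γ`, `-γ` is nonnegative yields a point of a graph, and testing the inequality at
  -- that point itself shows that this constant is zero.
  rcases le_or_gt 0 γ with hγ | hγ
  · have hzA := hA.mem_of_related fun a a' ha ↦ hγ.trans (hAγ a a' ha)
    have hγ0 := hAγ z _ hzA
    rw [sub_self, zero_apply] at hγ0
    have hzB := hB.mem_of_related fun b b' hb ↦ (neg_nonneg.2 hγ0).trans (hBγ b b' hb)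
    exact ⟨_, hzA, _, hzB, sub_add_cancel _ _⟩
  · have hzB := hB.mem_of_related fun b b' hb ↦ (neg_pos.2 hγ).le.trans (hBγ b b' hb)
    have := hBγ z _ hzB
    rw [sub_self, zero_apply] at this
    linarith

/-- The sum theorem when `M` is of type (FPV) and `dom M ⊆ dom B`. -/
theorem IsMaximalMonotoneFPV.add [CompleteSpace X] {M B : X → Set (StrongDual ℝ X)}
    (hM : IsMaximalMonotoneFPV M) (hB : IsMaximalMonotone B) (hMB : dom M ⊆ dom B)
    (hint : (dom M ∩ interior (dom B)).Nonempty) : IsMaximalMonotone (M + B) := by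
  obtain ⟨x₀, hx₀, hx₀B⟩ := hint
  obtain ⟨r, hr, K, -, hloc⟩ := hB.1.exists_norm_le_of_mem_interior_dom hx₀B
  refine ⟨hM.1.1.add hB.1, fun T hT hMT ↦ Set.Subset.antisymm ?_ hMT⟩
  rintro ⟨z, z'⟩ hz
  exact mem_add_of_related hM.1 hB hx₀ hr hloc
    (fun x x' _ hε ↦ exists_sub_apply_lt_of_FPV_add hM hB.1 hMB hx₀ hx₀B x x' hε)
    fun c c' hc ↦ hT.apply_nonneg hz (hMT (show (c, c') ∈ graph (M + B) from hc))

theorem normalCone_closure_dom_add {B : X → Set (StrongDual ℝ X)} (hB : IsMaximalMonotone B) :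
    normalCone (closure (dom B)) + B = B := by
  ext x x'
  constructor
  · rintro ⟨n, ⟨-, hn⟩, b, hb, rfl⟩
    refine hB.mem_of_related fun y y' hy ↦ ?_
    have h1 := hn y (subset_closure ⟨y', hy⟩)
    have h2 := hB.1.apply_nonneg hb hy
    simp only [sub_apply, add_apply, map_sub] at *
    linarith
  · exact fun hx ↦ ⟨0, ⟨subset_closure ⟨x', hx⟩, by simp⟩, x', hx, zero_add x'⟩

end

end MonotoneOp

theorem theorem3p4 {X : Type*} [NormedAddCommGroup X] [NormedSpace ℝ X] [CompleteSpace X]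
    (A B : X → Set (StrongDual ℝ X))
    (hA : MonotoneOp.IsMaximalMonotone A) (hB : MonotoneOp.IsMaximalMonotone B)
    (hAB : (MonotoneOp.dom A ∩ interior (MonotoneOp.dom B)).Nonempty)
    (hFPV : MonotoneOp.IsMaximalMonotoneFPV
      (A + MonotoneOp.normalCone (closure (MonotoneOp.dom B))))
    (hdom : MonotoneOp.dom A ∩ closure (MonotoneOp.dom B) ⊆ MonotoneOp.dom B) :
    MonotoneOp.IsMaximalMonotone (A + B) := by
  have hx : A + B = A + MonotoneOp.normalCone (closure (MonotoneOp.dom B)) + B := by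
    rw [add_assoc, MonotoneOp.normalCone_closure_dom_add hB]
  rw [hx]
  refine hFPV.add hB ?_ ?_
  · rintro x ⟨_, a, ha, n, ⟨hxC, -⟩, rfl⟩
    exact hdom ⟨⟨a, ha⟩, hxC⟩
  · obtain ⟨x, ⟨a, ha⟩, hxB⟩ := hAB
    exact ⟨x, ⟨a + 0, Set.add_mem_add ha ⟨subset_closure (interior_subset hxB), by simp⟩⟩, hxB⟩
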